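/- All operators act on $\mathbb C^2\otimes\mathbb C^2\otimes\mathbb C^2$, with tensor factors $A_1,A_2,A_3$, and states are not required to be normalized. A three-qubit rank-four PPT entangled state is a positive semidefinite operator of rank four whose partial transposes with respect to $A_1$, $A_2$ and $A_3$ are all positive semidefinite and which is not a finite sum of operators $|a\otimes b\otimes c\rangle\langle a\otimes b\otimes c|$ with $a,b,c\in\mathbb C^2$. Two such states $P,Q$ are SLOCC-equivalent if $P=VQV^\dagger$ for some $V=V_1\otimes V_2\otimes V_3$ with $V_1,V_2,V_3\in GL_2(\mathbb C)$. Let $P,Q$ be three-qubit rank-four PPT entangled states such that $$P=\sum_{i=1}^4|\alpha_i\rangle\langle\alpha_i|_{A_1}\otimes|\psi_i\rangle\langle\psi_i|_{A_2A_3},\qquad Q=\sum_{i=1}^4|\beta_i\rangle\langle\beta_i|_{A_1}\otimes|\varphi_i\rangle\langle\varphi_i|_{A_2A_3},$$ where any two of the $\alpha_i\in\mathbb C^2$ are linearly independent, the four vectors $\psi_i\in\mathbb C^2\otimes\mathbb C^2$ are linearly independent and each of them is entangled (not of the form $b\otimes c$), and likewise for the $\beta_i$ and the $\varphi_i$. (i)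 $P$ and $Q$ are SLOCC-equivalent if and only if there are $W=W_1\otimes W_2\otimes W_3$ with $W_1,W_2,W_3\in GL_2(\mathbb C)$, a permutation $\sigma$ of $\{1,2,3,4\}$ and nonzero complex numbers $d_1,\dots,d_4$ such that $$\alpha_i\otimes\psi_i=d_i\,W\,(\beta_{\sigma(i)}\otimes\varphi_{\sigma(i)}),\qquad i=1,2,3,4.$$ Moreover, in this equivalence one can choose $W,\sigma,d_1,\dots,d_4$ with $|d_i|=1$ for all $i$; that is, the equivalence remains true when "nonzero $d_i$" is replaced by "$|d_i|=1$". (ii) If $P$ and $Q$ are SLOCC-equivalent, then they have the same characteristic set. Here the characteristic set of $P$ is the set of all $t\in\mathbb C$ for which there are a permutation $\sigma$ of $\{1,2,3,4\}$, an invertible $2\times2$ matrix $V$ and an invertible diagonal $4\times 4$ matrix $D$ with $$V(\alpha_{\sigma(1)},\alpha_{\sigma(2)},\alpha_{\sigma(3)},\alpha_{\sigma(4)})D=\begin{pmatrix}1&0&1&t\\0&1&1&1\end{pmatrix},$$ and the characteristic set of $Q$ is defined in the same way from the $\beta_i$. -/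

import Mathlib

open scoped Kronecker ComplexOrder

/-- Index set of the standard basis of `ℂ² ⊗ ℂ² ⊗ ℂ²`; the components belong to the
subsystems `A₁`, `A₂`, `A₃`. -/
abbrev Idx3 : Type := Fin 2 × (Fin 2 × Fin 2)

/-- Operators on three qubits. -/
abbrev Op3 : Type := Matrix Idx3 Idx3 ℂ

/-- The tensor product `u ⊗ v` of two coordinate vectors. -/
def vecTensor {m n : Type*} (u : m → ℂ) (v : n → ℂ) : m × n → ℂ :=
  fun p => u p.1 * v p.2

/-- The rank-one operator `|v⟩⟨v|`. -/
def ketbra {n : Type*} (v : n → ℂ) : Matrix n n ℂ :=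
  Matrix.vecMulVec v (star v)

/-- Partial transpose with respect to the subsystem `A₁`. -/
def partialTranspose1 (ρ : Op3) : Op3 :=
  Matrix.of fun x y => ρ (y.1, x.2.1, x.2.2) (x.1, y.2.1, y.2.2)

/-- Partial transpose with respect to the subsystem `A₂`. -/
def partialTranspose2 (ρ : Op3) : Op3 :=
  Matrix.of fun x y => ρ (x.1, y.2.1, x.2.2) (y.1, x.2.1, y.2.2)

/-- Partial transpose with respect to the subsystem `A₃`. -/
def partialTranspose3 (ρ : Op3) : Op3 :=
  Matrix.of fun x y => ρ (x.1, x.2.1, y.2.2) (y.1, y.2.1, x.2.2)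

/-- A positive semidefinite operator whose partial transposes are all positive semidefinite.
The partial transpose with respect to two subsystems is the transpose of the one with
respect to the third, so it needs no separate condition. -/
def IsPPT (ρ : Op3) : Prop :=
  ρ.PosSemidef ∧ (partialTranspose1 ρ).PosSemidef ∧
    (partialTranspose2 ρ).PosSemidef ∧ (partialTranspose3 ρ).PosSemidef

/-- Full separability: a finite combination, with nonnegative coefficients, of operators
`|z⟩⟨z|` with `z = a ⊗ b ⊗ c`. States are not normalized here, so the
coefficients are not required to sum to one. -/
def IsFullySeparable (ρ : Op3) : Prop :=
  ∃ (n : ℕ) (p : Fin n → ℝ) (a b c : Fin n → Fin 2 → ℂ),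
    (∀ i, 0 ≤ p i) ∧
      ρ = ∑ i, (p i : ℂ) • ketbra (vecTensor (a i) (vecTensor (b i) (c i)))

/-- Three-qubit PPT entangled states of rank four, up to normalization. -/
structure IsRankFourPPTES (ρ : Op3) : Prop where
  ppt : IsPPT ρ
  entangled : ¬ IsFullySeparable ρ
  rank_eq : ρ.rank = 4

/-- A two-qubit vector is entangled if it is not a product vector. -/
def IsEntangledVec (ψ : Fin 2 × Fin 2 → ℂ) : Prop :=
  ¬ ∃ b c : Fin 2 → ℂ, ψ = vecTensor b c

/-- `ρ = ∑ᵢ |αᵢ⟩⟨αᵢ| ⊗ |ψᵢ⟩⟨ψᵢ|` on `A₁ | A₂A₃`, where any two of the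
`αᵢ` are linearly independent and the four `ψᵢ` are linearly independent and entangled. -/
structure IsBiseparableForm (ρ : Op3) (α : Fin 4 → Fin 2 → ℂ)
    (ψ : Fin 4 → Fin 2 × Fin 2 → ℂ) : Prop where
  eq_sum : ρ = ∑ i, ketbra (α i) ⊗ₖ ketbra (ψ i)
  pairwise_indep : ∀ i j, i ≠ j → LinearIndependent ℂ ![α i, α j]
  indep : LinearIndependent ℂ ψ
  entangled : ∀ i, IsEntangledVec (ψ i)

/-- The product transformation `W₁ ⊗ W₂ ⊗ W₃`. -/
def prodOp (W₁ W₂ W₃ : Matrix (Fin 2) (Fin 2) ℂ) : Op3 :=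
  W₁ ⊗ₖ (W₂ ⊗ₖ W₃)

/-- SLOCC-equivalence: `P = V Q V†` for some `V = V₁ ⊗ V₂ ⊗ V₃` with invertible factors.
A positive scalar factor can be absorbed into `V`. -/
def SLOCCEquivalent (P Q : Op3) : Prop :=
  ∃ V₁ V₂ V₃ : GL (Fin 2) ℂ,
    P = prodOp V₁.val V₂.val V₃.val * Q * (prodOp V₁.val V₂.val V₃.val).conjTranspose

/-- The characteristic set: all `t` such that, for some permutation `σ` and some
invertible `V` and invertible diagonal `D`, the matrix with columns
`α (σ 0), …, α (σ 3)` is brought to the standard form by `V` and `D`. -/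
def characteristicSet (α : Fin 4 → Fin 2 → ℂ) : Set ℂ :=
  {t | ∃ (σ : Equiv.Perm (Fin 4)) (V : GL (Fin 2) ℂ) (δ : Fin 4 → ℂ),
    (∀ i, δ i ≠ 0) ∧
      V.val * (Matrix.of fun r i => α (σ i) r) * Matrix.diagonal δ =
        !![1, 0, 1, t; 0, 1, 1, 1]}

/-- The relation `αᵢ ⊗ ψᵢ = dᵢ W (β_{σ(i)} ⊗ φ_{σ(i)})`, `i = 1, …, 4`, where
`W = W₁ ⊗ W₂ ⊗ W₃`. -/
def ProductVectorsMatch (α β : Fin 4 → Fin 2 → ℂ) (ψ φ : Fin 4 → Fin 2 × Fin 2 → ℂ)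
    (W₁ W₂ W₃ : GL (Fin 2) ℂ) (σ : Equiv.Perm (Fin 4)) (d : Fin 4 → ℂ) : Prop :=
  ∀ i, vecTensor (α i) (ψ i) =
    d i • (prodOp W₁.val W₂.val W₃.val).mulVec (vecTensor (β (σ i)) (φ (σ i)))

/-! Write `x i` for `vecTensor (α i) (ψ i)`. Since the `ψ i` are independent and the `α i` pairwise
independent, the only products on A₁|A₂A₃ in the span of the `x i` are multiples of single `x i`
(`IsBiseparableForm.coeff_eq_zero`). If `P = V Q V†`, the `x i` and the transported vectors of `Q`
differ by a unitary matrix; it must be monomial, which yields the permutation and the phases.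

For the converse, the `|d i|` must be shown equal (`IsBiseparableForm.norm_eq`); their common value
is then absorbed into `W₁`. Contracting A₂ with `b` turns the `x i` into the columns of a 4×4 matrix
`X_b`. Positivity of the partial transpose on A₂ makes some `X_b` invertible. In `X_c = X_b M`, each
row norm of `M` is at least the corresponding column norm. Rescaling the `x i` conjugates `M` by a
diagonal matrix, and the same bounds then force `M` to be block diagonal if the moduli differ. One
block has size at most two, so `M` has an eigenvector `v` supported there, with eigenvalue `l`, and
`X_{c - l b} v = 0`. Entangled `ψ i` exclude this unless `c = l b`. -/

/-! ### Sums of rank-one operators. -/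

/-- The matrix whose columns are the vectors `x i`. -/
def columns {m n : Type*} (x : n → m → ℂ) : Matrix m n ℂ := Matrix.of fun p i => x i p

theorem sum_ketbra {m n : Type*} [Fintype n] (x : n → m → ℂ) :
    ∑ i, ketbra (x i) = columns x * (columns x).conjTranspose := by
  ext p q
  simp [Matrix.sum_apply, ketbra, columns, Matrix.mul_apply, Matrix.vecMulVec_apply]

theorem ketbra_kronecker {m n : Type*} (a : m → ℂ) (b : n → ℂ) :
    ketbra a ⊗ₖ ketbra b = ketbra (vecTensor a b) := by
  ext p q
  simp [ketbra, vecTensor, Matrix.vecMulVec_apply]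
  ring

theorem ketbra_smul {m : Type*} (c : ℂ) (x : m → ℂ) :
    ketbra (c • x) = ((‖c‖ : ℂ) ^ 2) • ketbra x := by
  ext p q
  simp [ketbra, Matrix.vecMulVec_apply, ← Complex.mul_conj']
  ring

theorem mul_ketbra_mul {m : Type*} [Fintype m] (V : Matrix m m ℂ) (x : m → ℂ) :
    V * ketbra x * V.conjTranspose = ketbra (V.mulVec x) := by
  rw [ketbra, ketbra, Matrix.mul_vecMulVec, Matrix.vecMulVec_mul, Matrix.star_mulVec]

theorem IsBiseparableForm.eq_sum_ketbra {ρ : Op3} {α : Fin 4 → Fin 2 → ℂ}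
    {ψ : Fin 4 → Fin 2 × Fin 2 → ℂ} (h : IsBiseparableForm ρ α ψ) :
    ρ = ∑ i, ketbra (vecTensor (α i) (ψ i)) := by
  simp only [h.eq_sum, ketbra_kronecker]

theorem IsBiseparableForm.ne_zero {ρ : Op3} {α : Fin 4 → Fin 2 → ℂ}
    {ψ : Fin 4 → Fin 2 × Fin 2 → ℂ} (h : IsBiseparableForm ρ α ψ) (i : Fin 4) : α i ≠ 0 := by
  obtain ⟨j, hj⟩ : ∃ j, i ≠ j := (exists_ne i).imp fun _ => Ne.symm
  simpa using (h.pairwise_indep i j hj).ne_zero 0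

/-! ### Product vectors in the span, and the unitary freedom of decompositions. -/

/-- In a combination of the `αⱼ ⊗ ψⱼ` with independent `ψⱼ`, every `αⱼ` that occurs is
proportional to `a` if the combination is of the form `a ⊗ χ`. -/
theorem coeff_of_sum_eq_vecTensor {n ι : Type*} [Fintype ι] {α : ι → Fin 2 → ℂ} {ψ : ι → n → ℂ}
    (hψ : LinearIndependent ℂ ψ) {c : ι → ℂ} {a : Fin 2 → ℂ} {χ : n → ℂ}
    (h : ∑ j, c j • vecTensor (α j) (ψ j) = vecTensor a χ) (j : ι) (hc : c j ≠ 0) :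
    α j 0 * a 1 = α j 1 * a 0 := by
  -- Contracting A₁ with the functional `(a 1, -a 0)`, which kills `a`, leaves a relation among the
  -- `ψ j`.
  have key : ∑ j, (c j * (α j 0 * a 1 - α j 1 * a 0)) • ψ j = 0 := by
    ext q
    have h0 := congrFun h (0, q)
    have h1 := congrFun h (1, q)
    simp only [Finset.sum_apply, Pi.smul_apply, vecTensor, smul_eq_mul] at h0 h1
    simp only [Finset.sum_apply, Pi.smul_apply, smul_eq_mul, Pi.zero_apply]
    have : ∑ j, c j * (α j 0 * a 1 - α j 1 * a 0) * ψ j q =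
        a 1 * ∑ j, c j * (α j 0 * ψ j q) - a 0 * ∑ j, c j * (α j 1 * ψ j q) := by
      rw [Finset.mul_sum, Finset.mul_sum, ← Finset.sum_sub_distrib]
      exact Finset.sum_congr rfl fun _ _ => by ring
    rw [this, h0, h1]
    ring
  have := Fintype.linearIndependent_iff.1 hψ _ key j
  rcases mul_eq_zero.1 this with h | h
  · exact absurd h hc
  · exact sub_eq_zero.1 h

theorem not_linearIndependent_pair {a b c : Fin 2 → ℂ} (ha : a ≠ 0)
    (hb : b 0 * a 1 = b 1 * a 0) (hc : c 0 * a 1 = c 1 * a 0) :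
    ¬ LinearIndependent ℂ ![b, c] := by
  intro h
  rw [LinearIndependent.pair_iff] at h
  rcases Function.ne_iff.1 ha with ⟨r, hr⟩
  fin_cases r
  · have := h (c 0) (-b 0) (by
      ext k; fin_cases k
      · simp; ring
      · have hr : a 0 ≠ 0 := hr
        refine mul_right_cancel₀ hr ?_
        change (c 0 * b 1 + -b 0 * c 1) * a 0 = 0 * a 0
        linear_combination b 0 * hc - c 0 * hb)
    have h0 : b 0 = 0 := by simpa using this.2
    have h1 : b 1 = 0 := by
      have hr : a 0 ≠ 0 := hr
      rw [h0, zero_mul] at hb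
      exact (mul_eq_zero.1 hb.symm).resolve_right hr
    have := h 1 0 (by ext k; fin_cases k <;> simp [h0, h1])
    exact one_ne_zero this.1
  · have hr : a 1 ≠ 0 := hr
    have := h (c 1) (-b 1) (by
      ext k; fin_cases k
      · refine mul_right_cancel₀ hr ?_
        change (c 1 * b 0 + -b 1 * c 0) * a 1 = 0 * a 1
        linear_combination c 1 * hb - b 1 * hc
      · simp; ring)
    have h0 : b 1 = 0 := by simpa using this.2
    have h1 : b 0 = 0 := by
      rw [h0, zero_mul] at hb
      exact (mul_eq_zero.1 hb).resolve_right hr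
    have := h 1 0 (by ext k; fin_cases k <;> simp [h0, h1])
    exact one_ne_zero this.1

theorem IsBiseparableForm.linearIndependent {ρ : Op3} {α : Fin 4 → Fin 2 → ℂ}
    {ψ : Fin 4 → Fin 2 × Fin 2 → ℂ} (h : IsBiseparableForm ρ α ψ) :
    LinearIndependent ℂ fun i => vecTensor (α i) (ψ i) := by
  rw [Fintype.linearIndependent_iff]
  intro c hc j
  by_contra hcj
  -- The zero vector is a product with either basis vector as first factor, so an `α j` that occurs
  -- would be proportional to both.
  have h0 : ∑ j, c j • vecTensor (α j) (ψ j) = vecTensor ![1, 0] 0 := by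
    rw [hc]; ext; simp [vecTensor]
  have h1 : ∑ j, c j • vecTensor (α j) (ψ j) = vecTensor ![0, 1] 0 := by
    rw [hc]; ext; simp [vecTensor]
  have h0 := coeff_of_sum_eq_vecTensor h.indep h0 j hcj
  have h1 := coeff_of_sum_eq_vecTensor h.indep h1 j hcj
  apply h.ne_zero j
  ext k; fin_cases k
  · simpa using h1
  · simpa using h0.symm

/-- A vector in the span of the `αⱼ ⊗ ψⱼ` that is a product on `A₁ | A₂A₃` is a multiple of one
of them. -/
theorem IsBiseparableForm.coeff_eq_zero {ρ : Op3} {α : Fin 4 → Fin 2 → ℂ}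
    {ψ : Fin 4 → Fin 2 × Fin 2 → ℂ} (h : IsBiseparableForm ρ α ψ) {c : Fin 4 → ℂ}
    {a : Fin 2 → ℂ} {χ : Fin 2 × Fin 2 → ℂ} (ha : a ≠ 0)
    (hc : ∑ j, c j • vecTensor (α j) (ψ j) = vecTensor a χ) {i j : Fin 4} (hi : c i ≠ 0)
    (hij : i ≠ j) : c j = 0 := by
  by_contra hj
  exact not_linearIndependent_pair ha (coeff_of_sum_eq_vecTensor h.indep hc i hi)
    (coeff_of_sum_eq_vecTensor h.indep hc j hj) (h.pairwise_indep i j hij)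

theorem exists_left_inverse_columns {m n : Type*} [Fintype m] [Fintype n] [DecidableEq m]
    [DecidableEq n] {x : n → m → ℂ} (hx : LinearIndependent ℂ x) :
    ∃ L : Matrix n m ℂ, L * columns x = 1 := by
  have : Function.Injective (columns x).mulVec := by
    rw [Matrix.mulVec_injective_iff]
    exact hx
  obtain ⟨g, hg⟩ := (columns x).mulVecLin.exists_leftInverse_of_injective
    (LinearMap.ker_eq_bot.2 this)
  refine ⟨LinearMap.toMatrix' g, ?_⟩
  rw [← LinearMap.toMatrix'_toLin' (columns x), ← LinearMap.toMatrix'_comp,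
    Matrix.toLin'_apply', hg, LinearMap.toMatrix'_id]

/-- Two decompositions of an operator into as many independent vectors differ by a unitary
matrix. -/
theorem exists_unitary_of_sum_ketbra_eq {m n : Type*} [Fintype m] [Fintype n] [DecidableEq m]
    [DecidableEq n] {x y : n → m → ℂ} (hx : LinearIndependent ℂ x) (hy : LinearIndependent ℂ y)
    (h : ∑ i, ketbra (x i) = ∑ i, ketbra (y i)) :
    ∃ C : Matrix n n ℂ, C.conjTranspose * C = 1 ∧ columns y = columns x * C := by
  rw [sum_ketbra, sum_ketbra] at h
  obtain ⟨K, hK⟩ := exists_left_inverse_columns hx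
  obtain ⟨L, hL⟩ := exists_left_inverse_columns hy
  have hL' : (columns y).conjTranspose * L.conjTranspose = 1 := by
    rw [← Matrix.conjTranspose_mul, hL, Matrix.conjTranspose_one]
  have hK' : (columns x).conjTranspose * K.conjTranspose = 1 := by
    rw [← Matrix.conjTranspose_mul, hK, Matrix.conjTranspose_one]
  have hC : columns y = columns x * ((columns x).conjTranspose * L.conjTranspose) := by
    rw [← Matrix.mul_assoc, h, Matrix.mul_assoc, hL', Matrix.mul_one]
  set C := (columns x).conjTranspose * L.conjTranspose
  refine ⟨C, ?_, hC⟩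
  -- For square `C` it suffices that `C C† = 1`; cancel `X` and `X†` in `X C C† X† = X X†` with the
  -- left inverse `K`.
  rw [mul_eq_one_comm]
  rw [hC, Matrix.conjTranspose_mul] at h
  calc C * C.conjTranspose = (K * columns x) * C * C.conjTranspose *
        ((columns x).conjTranspose * K.conjTranspose) := by
          rw [hK, hK', Matrix.one_mul, Matrix.mul_one]
    _ = K * (columns x * C * (C.conjTranspose * (columns x).conjTranspose)) *
        K.conjTranspose := by simp only [Matrix.mul_assoc]
    _ = (K * columns x) * ((columns x).conjTranspose * K.conjTranspose) := by
        rw [← h]; simp only [Matrix.mul_assoc]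
    _ = 1 := by rw [hK, hK', Matrix.one_mul]

/-! ### Local operators, and matching vectors from SLOCC-equivalence. -/

theorem prodOp_mulVec_vecTensor (W₁ W₂ W₃ : Matrix (Fin 2) (Fin 2) ℂ) (a : Fin 2 → ℂ)
    (χ : Fin 2 × Fin 2 → ℂ) :
    (prodOp W₁ W₂ W₃).mulVec (vecTensor a χ) =
      vecTensor (W₁.mulVec a) ((W₂ ⊗ₖ W₃).mulVec χ) := by
  ext ⟨r, k, l⟩
  simp only [prodOp, Matrix.mulVec, dotProduct, vecTensor, Matrix.kroneckerMap_apply,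
    Fintype.sum_prod_type, Fin.sum_univ_two]
  ring

theorem isUnit_prodOp (W₁ W₂ W₃ : GL (Fin 2) ℂ) : IsUnit (prodOp W₁.val W₂.val W₃.val) := by
  have h : ∀ W : GL (Fin 2) ℂ, W.val * (W⁻¹).val = 1 := fun W => by
    rw [← Units.val_mul, mul_inv_cancel, Units.val_one]
  refine IsUnit.of_mul_eq_one (prodOp (W₁⁻¹).val (W₂⁻¹).val (W₃⁻¹).val) ?_
  rw [prodOp, prodOp, ← Matrix.mul_kronecker_mul, ← Matrix.mul_kronecker_mul, h, h, h,
    Matrix.one_kronecker_one, Matrix.one_kronecker_one]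

theorem GL_mulVec_ne_zero (W : GL (Fin 2) ℂ) {a : Fin 2 → ℂ} (ha : a ≠ 0) :
    W.val.mulVec a ≠ 0 := by
  intro h
  apply ha
  have := congrArg ((W⁻¹).val.mulVec) h
  rwa [Matrix.mulVec_mulVec, ← Units.val_mul, inv_mul_cancel, Units.val_one, Matrix.one_mulVec,
    Matrix.mulVec_zero] at this

theorem productVectorsMatch_of_SLOCC {P Q : Op3} {α β : Fin 4 → Fin 2 → ℂ}
    {ψ φ : Fin 4 → Fin 2 × Fin 2 → ℂ} (hP : IsBiseparableForm P α ψ)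
    (hQ : IsBiseparableForm Q β φ) (h : SLOCCEquivalent P Q) :
    ∃ (W₁ W₂ W₃ : GL (Fin 2) ℂ) (σ : Equiv.Perm (Fin 4)) (d : Fin 4 → ℂ),
      (∀ i, ‖d i‖ = 1) ∧ ProductVectorsMatch α β ψ φ W₁ W₂ W₃ σ d := by
  obtain ⟨V₁, V₂, V₃, hV⟩ := h
  set V := prodOp V₁.val V₂.val V₃.val with hVdef
  set y : Fin 4 → Idx3 → ℂ := fun i => V.mulVec (vecTensor (β i) (φ i)) with hydef
  have hy : LinearIndependent ℂ y := by
    have hinj : Function.Injective V.mulVec :=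
      Matrix.mulVec_injective_of_isUnit (isUnit_prodOp V₁ V₂ V₃)
    exact hQ.linearIndependent.map' V.mulVecLin (LinearMap.ker_eq_bot.2 hinj)
  have hsum : ∑ i, ketbra (vecTensor (α i) (ψ i)) = ∑ i, ketbra (y i) := by
    rw [← hP.eq_sum_ketbra, hV, hQ.eq_sum_ketbra, Finset.mul_sum, Finset.sum_mul]
    exact Finset.sum_congr rfl fun i _ => mul_ketbra_mul _ _
  obtain ⟨C, hC, hyC⟩ := exists_unitary_of_sum_ketbra_eq hP.linearIndependent hy hsum
  have hcol : ∀ i, ∑ j, C j i • vecTensor (α j) (ψ j) = y i := by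
    intro i
    ext p
    have := congrFun (congrFun hyC p) i
    rw [Matrix.mul_apply] at this
    simp only [columns, Matrix.of_apply] at this
    rw [this]
    simp [mul_comm]
  have hex : ∀ i, ∃ j, C j i ≠ 0 := by
    intro i
    by_contra hno
    push Not at hno
    apply hy.ne_zero i
    rw [← hcol i]
    simp [hno]
  choose τ hτ using hex
  have hzero : ∀ i j, j ≠ τ i → C j i = 0 := by
    intro i j hj
    refine hP.coeff_eq_zero (c := fun j => C j i)
      (χ := (V₂.val ⊗ₖ V₃.val).mulVec (φ i)) (GL_mulVec_ne_zero V₁ (hQ.ne_zero i)) ?_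
      (hτ i) hj.symm
    rw [hcol i, ← prodOp_mulVec_vecTensor]
  -- Column `i` of `C` has its only nonzero entry in row `τ i`, so `C† C = 1` reduces to one product
  -- per entry.
  have hentry : ∀ i k, star (C (τ i) i) * C (τ i) k = (1 : Matrix (Fin 4) (Fin 4) ℂ) i k := by
    intro i k
    rw [← hC, Matrix.mul_apply, Finset.sum_eq_single (τ i)]
    · rfl
    · intro j _ hj
      simp [hzero i j hj]
    · simp
  have hinj : Function.Injective τ := by
    intro i k hik
    by_contra hne
    have := hentry i k
    rw [Matrix.one_apply_ne hne] at this
    rcases mul_eq_zero.1 this with h | h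
    · exact hτ i (star_eq_zero.1 h)
    · rw [hik] at h
      exact hτ k h
  have hnorm : ∀ i, ‖C (τ i) i‖ = 1 := by
    intro i
    have := congrArg norm (hentry i i)
    rw [Matrix.one_apply_eq, norm_mul, norm_star, norm_one] at this
    nlinarith [norm_nonneg (C (τ i) i)]
  let e : Equiv.Perm (Fin 4) := Equiv.ofBijective τ (Finite.injective_iff_bijective.1 hinj)
  refine ⟨V₁, V₂, V₃, e.symm, fun i => (C i (e.symm i))⁻¹, fun i => ?_, fun i => ?_⟩
  · have := hnorm (e.symm i)
    rw [show τ (e.symm i) = i from e.apply_symm_apply i] at this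
    simp [this]
  · have h1 := hcol (e.symm i)
    have h2 := hτ (e.symm i)
    have hτi : τ (e.symm i) = i := e.apply_symm_apply i
    rw [hτi] at h2
    rw [Finset.sum_eq_single i (fun j _ hj => by rw [hzero _ j (by rwa [hτi]), zero_smul])
      (by simp)] at h1
    change _ = _ • y (e.symm i)
    rw [← h1, smul_smul, inv_mul_cancel₀ h2, one_smul]

/-! ### Linear algebra: pencils of maximal rank, row and column norms, eigenvectors. -/

theorem exists_linearIndependent_mulVec {m n : Type*} [Fintype n] [Finite m]
    (A : Matrix m n ℂ) :
    ∃ r : ℕ, r = A.rank ∧ ∃ v : Fin r → n → ℂ, LinearIndependent ℂ fun i => A.mulVec (v i) := by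
  refine ⟨Module.finrank ℂ (LinearMap.range A.mulVecLin), rfl, ?_⟩
  have hb := (Module.finBasis ℂ (LinearMap.range A.mulVecLin)).linearIndependent.map'
    _ (Submodule.ker_subtype _)
  choose v hv using fun i => (Module.finBasis ℂ (LinearMap.range A.mulVecLin) i).2
  refine ⟨v, ?_⟩
  have heq : (fun i => A.mulVec (v i)) = _ := funext hv
  rw [heq]
  exact hb

/-- If `A` has maximal rank in the pencil `A + z B`, then `B` maps the kernel of `A` into the
range of `A`. -/
theorem dotProduct_mulVec_eq_zero_of_rank_le {m n : Type*} [Fintype m] [Fintype n]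
    {A B : Matrix m n ℂ} (h : ∀ z : ℂ, (A + z • B).rank ≤ A.rank) {f : m → ℂ} {g : n → ℂ}
    (hf : Matrix.vecMul f A = 0) (hg : A.mulVec g = 0) : f ⬝ᵥ B.mulVec g = 0 := by
  by_contra hne
  obtain ⟨r, hr, v, hb⟩ := exists_linearIndependent_mulVec A
  -- At `z = 0` these are a basis of the range of `A` together with `B g`, which `f` separates from
  -- that range. Independence is an open condition, and for `z ≠ 0` the vector `B g = z⁻¹ (A + z B)
  -- g` lies in the range of `A + z B`, whose rank then exceeds that of `A`.
  let F : ℂ → Option (Fin r) → m → ℂ := fun z o =>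
    o.elim (B.mulVec g) fun i => (A + z • B).mulVec (v i)
  have hF0 : LinearIndependent ℂ (F 0) := by
    rw [linearIndependent_option]
    constructor
    · simpa [F, Function.comp_def] using hb
    · intro hmem
      apply hne
      have hle : Submodule.span ℂ (Set.range (F 0 ∘ ((↑) : Fin r → Option _))) ≤
          LinearMap.ker (dotProductBilin ℂ ℂ f : (m → ℂ) →ₗ[ℂ] ℂ) := by
        rw [Submodule.span_le]
        rintro _ ⟨i, rfl⟩
        simp [F, Matrix.dotProduct_mulVec, hf]
      simpa [F] using hle hmem
  have hcont : Continuous F := by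
    refine continuous_pi fun o => ?_
    cases o with
    | none => exact continuous_const
    | some i =>
      simp only [F, Option.elim_some, Matrix.add_mulVec, Matrix.smul_mulVec]
      fun_prop
  have hev : ∀ᶠ z in nhds (0 : ℂ), LinearIndependent ℂ (F z) :=
    hcont.continuousAt.eventually hF0.eventually
  obtain ⟨z, hz, hz0⟩ := ((hev.filter_mono nhdsWithin_le_nhds).and
    (self_mem_nhdsWithin (s := {(0 : ℂ)}ᶜ))).exists
  have hz0 : z ≠ 0 := hz0
  have hmem : ∀ o, F z o ∈ LinearMap.range (A + z • B).mulVecLin := by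
    intro o
    cases o with
    | none =>
      refine ⟨z⁻¹ • g, ?_⟩
      simp [F, Matrix.add_mulVec, Matrix.smul_mulVec, hg, smul_smul, hz0]
    | some i => exact ⟨v i, rfl⟩
  have hz' : LinearIndependent ℂ fun o => (⟨F z o, hmem o⟩ : LinearMap.range _) :=
    LinearIndependent.of_comp (Submodule.subtype _) hz
  have := hz'.fintype_card_le_finrank
  rw [Fintype.card_option, Fintype.card_fin] at this
  exact absurd (h z) (by rw [not_le, ← hr]; exact this)

/-- If the squared row norms of a matrix dominate the column norms, before and after conjugation
by a diagonal matrix, then the matrix is block diagonal for the indices at which the diagonal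
entry is maximal. -/
theorem entries_eq_zero_of_row_col {ι : Type*} [Fintype ι] {N : ι → ι → ℝ} {t : ι → ℝ}
    (hN : ∀ i j, 0 ≤ N i j) (ht : ∀ i, 0 < t i) (h1 : ∀ j, ∑ i, N i j ≤ ∑ i, N j i)
    (h2 : ∀ j, ∑ i, N i j * (t j / t i) ≤ ∑ i, N j i * (t i / t j)) {j : ι}
    (hj : ∀ i, t i ≤ t j) {i : ι} (hi : t i ≠ t j) : N i j = 0 ∧ N j i = 0 := by
  have heq : ∑ i, N i j = ∑ i, N j i :=
    (Finset.sum_eq_sum_iff_of_le fun j _ => h1 j).1 Finset.sum_comm j (Finset.mem_univ j)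
  -- By maximality of `t j`: column ≤ weighted column ≤ weighted row ≤ row, and row = column by
  -- `heq`. Equality therefore holds term by term.
  have ha : ∀ i ∈ Finset.univ, N j i * (t i / t j) ≤ N j i := fun i _ =>
    mul_le_of_le_one_right (hN j i) ((div_le_one (ht j)).2 (hj i))
  have hb : ∀ i ∈ Finset.univ, N i j ≤ N i j * (t j / t i) := fun i _ =>
    le_mul_of_one_le_right (hN i j) ((one_le_div (ht i)).2 (hj i))
  have hsa := Finset.sum_le_sum ha
  have hsb := Finset.sum_le_sum hb
  have ea := (Finset.sum_eq_sum_iff_of_le ha).1 (by linarith [h2 j]) i (Finset.mem_univ i)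
  have eb := (Finset.sum_eq_sum_iff_of_le hb).1 (by linarith [h2 j]) i (Finset.mem_univ i)
  constructor
  · by_contra h
    have : t j / t i = 1 := mul_left_cancel₀ h (by rw [← eb, mul_one])
    exact hi ((div_eq_one_iff_eq (ht i).ne').1 this).symm
  · by_contra h
    have : t i / t j = 1 := mul_left_cancel₀ h (by rw [ea, mul_one])
    exact hi ((div_eq_one_iff_eq (ht j).ne').1 this)

/-- The vectors supported on `J` form a nonzero invariant subspace, and over ℂ the restriction of
`M` to it has an eigenvalue. -/
theorem exists_eigenvector_supported {ι : Type*} [Fintype ι] {M : Matrix ι ι ℂ} {J : Finset ι}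
    (hJ : J.Nonempty) (hM : ∀ i ∉ J, ∀ j ∈ J, M i j = 0) :
    ∃ (l : ℂ) (v : ι → ℂ), v ≠ 0 ∧ (∀ i ∉ J, v i = 0) ∧ M.mulVec v = l • v := by
  classical
  let S : Submodule ℂ (ι → ℂ) :=
    { carrier := {v | ∀ i ∉ J, v i = 0}
      add_mem' := fun {a b} ha hb i hi => by simp [ha i hi, hb i hi]
      zero_mem' := fun _ _ => rfl
      smul_mem' := fun c a ha i hi => by simp [ha i hi] }
  have hS : ∀ v ∈ S, M.mulVecLin v ∈ S := by
    intro v hv i hi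
    refine Finset.sum_eq_zero fun j _ => ?_
    by_cases hj : j ∈ J
    · simp [hM i hi j hj]
    · simp [hv j hj]
  obtain ⟨j, hj⟩ := hJ
  have : Nontrivial S := by
    refine ⟨⟨⟨Pi.single j 1, fun i hi => ?_⟩, 0, fun h => ?_⟩⟩
    · exact Pi.single_eq_of_ne (by rintro rfl; exact hi hj) _
    · simpa using congrFun (congrArg Subtype.val h) j
  obtain ⟨l, hl⟩ := Module.End.exists_eigenvalue (M.mulVecLin.restrict hS)
  obtain ⟨v, hv⟩ := hl.exists_hasEigenvector
  refine ⟨l, v, fun h => hv.2 (Subtype.ext h), v.2, ?_⟩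
  exact congrArg Subtype.val hv.apply_eq_smul

/-! ### Slices and positivity of the partial transpose on A₂. -/

/-- The coefficient matrices, on `A₁A₃`, of the vectors `x i` contracted with `b` on `A₂`. -/
def slice (x : Fin 4 → Idx3 → ℂ) (b : Fin 2 → ℂ) : Matrix (Fin 2 × Fin 2) (Fin 4) ℂ :=
  Matrix.of fun p i => ∑ k, b k * x i (p.1, k, p.2)

/-- Positivity of the partial transpose on `A₂` of `∑ᵢ |xᵢ⟩⟨xᵢ|`, tested on the vectors
`b ⊗ u + c ⊗ v`. -/
def SliceInequality (x : Fin 4 → Idx3 → ℂ) : Prop :=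
  ∀ (b c : Fin 2 → ℂ) (u v : Fin 2 × Fin 2 → ℂ),
    0 ≤ ∑ i, (Complex.normSq (Matrix.vecMul u (slice x b) i) +
      Complex.normSq (Matrix.vecMul v (slice x c) i) +
      2 * (Matrix.vecMul u (slice x c) i * star (Matrix.vecMul v (slice x b) i)).re)

theorem slice_add_smul (x : Fin 4 → Idx3 → ℂ) (b c : Fin 2 → ℂ) (z : ℂ) :
    slice x (b + z • c) = slice x b + z • slice x c := by
  ext p i
  simp [slice, add_mul]
  ring

theorem vecMul_slice (x : Fin 4 → Idx3 → ℂ) (b : Fin 2 → ℂ) (u : Fin 2 × Fin 2 → ℂ) (i : Fin 4) :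
    Matrix.vecMul u (slice x b) i = ∑ k, b k * ∑ p : Fin 2 × Fin 2, u p * x i (p.1, k, p.2) := by
  simp only [Matrix.vecMul, dotProduct, slice, Matrix.of_apply, Finset.mul_sum]
  rw [Finset.sum_comm]
  exact Finset.sum_congr rfl fun _ _ => Finset.sum_congr rfl fun _ _ => by ring

theorem partialTranspose2_ketbra_form (x z : Idx3 → ℂ) :
    star z ⬝ᵥ (partialTranspose2 (ketbra x)).mulVec z =
      ∑ k, ∑ k', (∑ p : Fin 2 × Fin 2, star (z (p.1, k, p.2)) * x (p.1, k', p.2)) *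
        star (∑ p : Fin 2 × Fin 2, star (z (p.1, k', p.2)) * x (p.1, k, p.2)) := by
  simp only [partialTranspose2, ketbra, Matrix.mulVec, dotProduct, Matrix.of_apply,
    Matrix.vecMulVec_apply, Pi.star_apply, Fintype.sum_prod_type, Fin.sum_univ_two, star_add,
    star_mul', star_star]
  ring

theorem partialTranspose2_sum {ι : Type*} (s : Finset ι) (f : ι → Op3) :
    partialTranspose2 (∑ i ∈ s, f i) = ∑ i ∈ s, partialTranspose2 (f i) := by
  ext
  simp [partialTranspose2, Matrix.sum_apply]

theorem sliceInequality_of_posSemidef {x : Fin 4 → Idx3 → ℂ}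
    (h : (partialTranspose2 (∑ i, ketbra (x i))).PosSemidef) : SliceInequality x := by
  intro b c u v
  -- Conjugating `u` and `v` makes the quadratic form an expression in `vecMul u` and `vecMul v`
  -- without conjugates on them.
  let z : Idx3 → ℂ := fun q => b q.2.1 * star (u (q.1, q.2.2)) + c q.2.1 * star (v (q.1, q.2.2))
  have hz := h.dotProduct_mulVec_nonneg z
  rw [partialTranspose2_sum, Matrix.sum_mulVec, dotProduct_sum] at hz
  have key : ∀ i, star z ⬝ᵥ (partialTranspose2 (ketbra (x i))).mulVec z =
      Matrix.vecMul u (slice x b) i * star (Matrix.vecMul u (slice x b) i) +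
      Matrix.vecMul v (slice x c) i * star (Matrix.vecMul v (slice x c) i) +
      (Matrix.vecMul u (slice x c) i * star (Matrix.vecMul v (slice x b) i) +
        star (Matrix.vecMul u (slice x c) i * star (Matrix.vecMul v (slice x b) i))) := by
    intro i
    rw [partialTranspose2_ketbra_form]
    have hG : ∀ k k', ∑ p : Fin 2 × Fin 2, star (z (p.1, k, p.2)) * x i (p.1, k', p.2) =
        star (b k) * (∑ p : Fin 2 × Fin 2, u p * x i (p.1, k', p.2)) +
        star (c k) * (∑ p : Fin 2 × Fin 2, v p * x i (p.1, k', p.2)) := by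
      intro k k'
      rw [Finset.mul_sum, Finset.mul_sum, ← Finset.sum_add_distrib]
      refine Finset.sum_congr rfl fun p _ => ?_
      simp only [z, star_add, star_mul', star_star]
      ring
    simp only [hG, vecMul_slice]
    simp only [Fin.sum_univ_two, star_add, star_mul', star_star]
    ring
  simp only [key] at hz
  have := (Complex.le_def.1 hz).1
  rw [Complex.re_sum] at this
  refine this.trans_eq (Finset.sum_congr rfl fun i _ => ?_)
  simp only [Complex.add_re, Complex.star_def, Complex.mul_conj, Complex.ofReal_re,
    Complex.conj_re]
  ring

theorem SliceInequality.comp_equiv {x : Fin 4 → Idx3 → ℂ} (h : SliceInequality x)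
    (σ : Equiv.Perm (Fin 4)) : SliceInequality fun i => x (σ i) := by
  intro b c u v
  refine (h b c u v).trans_eq (Eq.symm ?_)
  exact Equiv.sum_comp σ fun i => (Complex.normSq (Matrix.vecMul u (slice x b) i) +
      Complex.normSq (Matrix.vecMul v (slice x c) i) +
      2 * (Matrix.vecMul u (slice x c) i * star (Matrix.vecMul v (slice x b) i)).re)

theorem slice_prodOp_mulVec (W₁ W₂ W₃ : Matrix (Fin 2) (Fin 2) ℂ) (x : Fin 4 → Idx3 → ℂ)
    (b : Fin 2 → ℂ) :
    slice (fun i => (prodOp W₁ W₂ W₃).mulVec (x i)) b =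
      (W₁ ⊗ₖ W₃) * slice x (Matrix.vecMul b W₂) := by
  ext ⟨r, l⟩ i
  simp only [slice, prodOp, Matrix.mulVec, Matrix.vecMul, dotProduct, Matrix.mul_apply,
    Matrix.of_apply, Matrix.kroneckerMap_apply, Fintype.sum_prod_type, Fin.sum_univ_two]
  ring

theorem SliceInequality.prodOp_mulVec {x : Fin 4 → Idx3 → ℂ} (h : SliceInequality x)
    (W₁ W₂ W₃ : Matrix (Fin 2) (Fin 2) ℂ) :
    SliceInequality fun i => (prodOp W₁ W₂ W₃).mulVec (x i) := by
  intro b c u v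
  simp only [slice_prodOp_mulVec, ← Matrix.vecMul_vecMul]
  exact h _ _ _ _

/-- If `f` annihilates one slice then it maps any other slice into the kernel of the first. -/
theorem SliceInequality.mulVec_eq_zero {x : Fin 4 → Idx3 → ℂ} (h : SliceInequality x)
    {b : Fin 2 → ℂ} {f : Fin 2 × Fin 2 → ℂ} (hf : Matrix.vecMul f (slice x b) = 0)
    (c : Fin 2 → ℂ) : (slice x b).mulVec (star (Matrix.vecMul f (slice x c))) = 0 := by
  rw [← star_eq_zero, Matrix.star_mulVec, star_star]
  set g := Matrix.vecMul f (slice x c)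
  ext p
  set w : ℂ := Matrix.vecMul g (slice x b).conjTranspose p with hw
  set N : ℝ := ∑ i, Complex.normSq (Matrix.vecMul (Pi.single p 1) (slice x c) i) with hN
  -- Testing with `s • f` removes the term quadratic in `s`; a real-affine function of `s` that is
  -- bounded below has zero slope, so `w = 0`.
  have key : ∀ s : ℂ, 0 ≤ N + 2 * (s * w).re := by
    intro s
    have := h b c (s • f) (Pi.single p 1)
    simp only [Matrix.smul_vecMul, hf, smul_zero, Pi.zero_apply, Complex.normSq_zero, zero_add,
      Finset.sum_add_distrib, ← Finset.mul_sum] at this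
    rw [← Complex.re_sum] at this
    convert this using 4
    rw [hw, Matrix.vecMul, dotProduct, Finset.mul_sum]
    refine Finset.sum_congr rfl fun i _ => ?_
    simp [g, mul_assoc]
  by_contra hne
  have hpos : 0 < Complex.normSq w := Complex.normSq_pos.2 hne
  have := key (((-(N + 1) / Complex.normSq w : ℝ) : ℂ) * star w)
  rw [mul_assoc, Complex.star_def, ← Complex.normSq_eq_conj_mul_self, ← Complex.ofReal_mul,
    Complex.ofReal_re, div_mul_cancel₀ _ hpos.ne'] at this
  have hN0 : 0 ≤ N := Finset.sum_nonneg fun _ _ => Complex.normSq_nonneg _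
  linarith

/-- Some slice is invertible, provided that no vector annihilates all of them. -/
theorem SliceInequality.exists_inverse {x : Fin 4 → Idx3 → ℂ} (h : SliceInequality x)
    (hx : ∀ f, (∀ c, Matrix.vecMul f (slice x c) = 0) → f = 0) :
    ∃ (b : Fin 2 → ℂ) (Y : Matrix (Fin 4) (Fin 2 × Fin 2) ℂ),
      slice x b * Y = 1 ∧ Y * slice x b = 1 := by
  -- A slice of maximal rank is taken. If `f` annihilates it, the pencil lemma with kernel vector
  -- `star (f X_c)` gives `f X_c ⬝ᵥ star (f X_c) = 0` for every `c`.
  obtain ⟨b, hb⟩ : ∃ b, ∀ c, (slice x c).rank ≤ (slice x b).rank := by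
    have hfin : (Set.range fun c => (slice x c).rank).Finite :=
      (Set.finite_le_nat 4).subset (by
        rintro _ ⟨c, rfl⟩
        simpa using (slice x c).rank_le_card_width)
    obtain ⟨_, ⟨⟨b, rfl⟩, hb⟩⟩ := hfin.exists_maximal (Set.range_nonempty _)
    refine ⟨b, fun c => ?_⟩
    by_contra hc
    exact hc (hb ⟨c, rfl⟩ (not_le.1 hc).le)
  have hinj : Function.Injective (slice x b).vecMulLinear := by
    rw [injective_iff_map_eq_zero]
    intro f hf
    have hf : Matrix.vecMul f (slice x b) = 0 := hf
    refine hx f fun c => ?_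
    have := dotProduct_mulVec_eq_zero_of_rank_le (A := slice x b) (B := slice x c)
      (fun z => by rw [← slice_add_smul]; exact hb _) hf (h.mulVec_eq_zero hf c)
    rw [Matrix.dotProduct_mulVec] at this
    exact dotProduct_self_star_eq_zero.1 this
  have hinj' : Function.Injective (slice x b).transpose.mulVecLin := by
    intro f g hfg
    apply hinj
    simpa using hfg
  obtain ⟨g, hg⟩ := (slice x b).transpose.mulVecLin.exists_leftInverse_of_injective
    (LinearMap.ker_eq_bot.2 hinj')
  have hY : slice x b * (LinearMap.toMatrix' g).transpose = 1 := by
    rw [← Matrix.transpose_inj, Matrix.transpose_mul, Matrix.transpose_transpose,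
      ← LinearMap.toMatrix'_toLin' (slice x b).transpose, ← LinearMap.toMatrix'_comp,
      Matrix.toLin'_apply', hg, LinearMap.toMatrix'_id, Matrix.transpose_one]
  exact ⟨b, _, hY, (Matrix.mul_eq_one_comm_of_card_eq _ _ _ (by simp)).1 hY⟩

/-- Relative to an invertible slice, the row norms of every other slice dominate its column
norms. -/
theorem SliceInequality.sum_normSq_le {x : Fin 4 → Idx3 → ℂ} (h : SliceInequality x)
    {b c : Fin 2 → ℂ} {Y : Matrix (Fin 4) (Fin 2 × Fin 2) ℂ} (hY : Y * slice x b = 1)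
    {M : Matrix (Fin 4) (Fin 4) ℂ} (hM : slice x c = slice x b * M) (j : Fin 4) :
    ∑ i, Complex.normSq (M i j) ≤ ∑ i, Complex.normSq (M j i) := by
  -- With `u X_b = p` and `v X_b` the `j`-th unit vector, the cross term is minus twice the squared
  -- norm of column `j`, leaving row minus column.
  let p : Fin 4 → ℂ := fun i => -star (M i j)
  have hu : ∀ q : Fin 4 → ℂ, Matrix.vecMul (Matrix.vecMul q Y) (slice x b) = q := fun q => by
    rw [Matrix.vecMul_vecMul, hY, Matrix.vecMul_one]
  have := h b c (Matrix.vecMul p Y) (Matrix.vecMul (Pi.single j 1) Y)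
  simp only [hM, ← Matrix.vecMul_vecMul, hu] at this
  simp only [Finset.sum_add_distrib, ← Finset.mul_sum] at this
  have h1 : ∑ i, Complex.normSq (p i) = ∑ i, Complex.normSq (M i j) := by simp [p]
  have h2 : ∑ i, (Matrix.vecMul p M i * star ((Pi.single j 1 : Fin 4 → ℂ) i)).re =
      -∑ i, Complex.normSq (M i j) := by
    rw [Finset.sum_eq_single j (fun i _ hi => by simp [Pi.single_eq_of_ne hi]) (by simp)]
    simp only [Pi.single_eq_same, star_one, mul_one, Matrix.vecMul, dotProduct, p, Complex.re_sum,
      ← Finset.sum_neg_distrib]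
    refine Finset.sum_congr rfl fun i _ => ?_
    rw [neg_mul, Complex.star_def, ← Complex.normSq_eq_conj_mul_self, Complex.neg_re,
      Complex.ofReal_re]
  have h3 : ∑ i, Complex.normSq (Matrix.vecMul (Pi.single j 1) M i) =
      ∑ i, Complex.normSq (M j i) := by simp
  rw [h1, h2, h3] at this
  linarith

/-! ### Contractions of entangled vectors, and invariance of the characteristic set. -/

/-- A nonzero `e` would make one row of the coefficient matrix of `ψ` a multiple of the other, so
`ψ` would be a product. -/
theorem isEntangledVec_contract_left {ψ : Fin 2 × Fin 2 → ℂ} (h : IsEntangledVec ψ)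
    {e : Fin 2 → ℂ} (he : ∀ l, ∑ k, e k * ψ (k, l) = 0) : e = 0 := by
  by_contra hne
  obtain ⟨r, hr⟩ := Function.ne_iff.1 hne
  simp only [Fin.sum_univ_two] at he
  apply h
  fin_cases r
  · have hr : e 0 ≠ 0 := hr
    refine ⟨![-(e 1) / e 0, 1], fun l => ψ (1, l), ?_⟩
    ext ⟨k, l⟩
    fin_cases k
    · simp only [vecTensor, Fin.zero_eta, Matrix.cons_val_zero]
      field_simp
      linear_combination he l
    · simp [vecTensor]
  · have hr : e 1 ≠ 0 := hr
    refine ⟨![1, -(e 0) / e 1], fun l => ψ (0, l), ?_⟩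
    ext ⟨k, l⟩
    fin_cases k
    · simp [vecTensor]
    · simp only [vecTensor, Fin.mk_one, Matrix.cons_val_one, Matrix.cons_val_fin_one]
      field_simp
      linear_combination he l

theorem isEntangledVec_contract_right {ψ : Fin 2 × Fin 2 → ℂ} (h : IsEntangledVec ψ)
    {e : Fin 2 → ℂ} (he : ∀ k, ∑ l, e l * ψ (k, l) = 0) : e = 0 := by
  refine isEntangledVec_contract_left (ψ := fun p => ψ p.swap) ?_ he
  rintro ⟨b, c, hbc⟩
  refine h ⟨c, b, ?_⟩
  ext ⟨k, l⟩
  have := congrFun hbc (l, k)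
  simpa [vecTensor, mul_comm] using this

theorem vec_eq_zero_of_linearIndependent {a b f : Fin 2 → ℂ} (h : LinearIndependent ℂ ![a, b])
    (ha : ∑ r, f r * a r = 0) (hb : ∑ r, f r * b r = 0) : f = 0 := by
  by_contra hf
  simp only [Fin.sum_univ_two] at ha hb
  refine not_linearIndependent_pair (a := ![-f 1, f 0]) (fun h0 => hf ?_) ?_ ?_ h
  · have h1 := congrFun h0 0
    have h2 := congrFun h0 1
    ext r
    fin_cases r
    · simpa using h2
    · simpa using h1
  · simp; linear_combination ha
  · simp; linear_combination hb

/-- The relation between the first factors of matching product vectors. -/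
theorem exists_smul_of_productVectorsMatch {α β : Fin 4 → Fin 2 → ℂ}
    {ψ φ : Fin 4 → Fin 2 × Fin 2 → ℂ} {W₁ W₂ W₃ : GL (Fin 2) ℂ} {σ : Equiv.Perm (Fin 4)}
    {d : Fin 4 → ℂ} (hα : ∀ i, α i ≠ 0) (hψ : ∀ i, ψ i ≠ 0)
    (h : ProductVectorsMatch α β ψ φ W₁ W₂ W₃ σ d) :
    ∃ c : Fin 4 → ℂ, (∀ i, c i ≠ 0) ∧ ∀ i, α i = c i • W₁.val.mulVec (β (σ i)) := by
  have : ∀ i, ∃ c : ℂ, α i = c • W₁.val.mulVec (β (σ i)) := by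
    intro i
    obtain ⟨q, hq⟩ := Function.ne_iff.1 (hψ i)
    have hq : ψ i q ≠ 0 := hq
    refine ⟨(d i * (W₂.val ⊗ₖ W₃.val).mulVec (φ (σ i)) q) / ψ i q, ?_⟩
    ext r
    have := congrFun (h i) (r, q)
    rw [prodOp_mulVec_vecTensor] at this
    simp only [vecTensor, Pi.smul_apply, smul_eq_mul] at this ⊢
    field_simp
    linear_combination this
  choose c hc using this
  refine ⟨c, fun i h0 => hα i ?_, hc⟩
  rw [hc i, h0, zero_smul]

/-- The permutation, `W` and the factors `c` are absorbed into the permutation, `V` and the diagonal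
matrix of the standard form. -/
theorem characteristicSet_subset {α β : Fin 4 → Fin 2 → ℂ} {W : GL (Fin 2) ℂ}
    {σ : Equiv.Perm (Fin 4)} {c : Fin 4 → ℂ} (hc : ∀ i, c i ≠ 0)
    (h : ∀ i, α i = c i • W.val.mulVec (β (σ i))) :
    characteristicSet α ⊆ characteristicSet β := by
  rintro t ⟨τ, V, δ, hδ, ht⟩
  refine ⟨τ.trans σ, V * W, fun i => c (τ i) * δ i, fun i => mul_ne_zero (hc _) (hδ i), ?_⟩
  have : (Matrix.of fun r i => α (τ i) r) =
      W.val * (Matrix.of fun r i => β ((τ.trans σ) i) r) *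
        Matrix.diagonal fun i => c (τ i) := by
    ext r i
    rw [Matrix.mul_diagonal, Matrix.of_apply, h, mul_comm]
    rfl
  rw [← ht, this, Units.val_mul]
  simp only [Matrix.mul_assoc, Matrix.diagonal_mul_diagonal]

theorem characteristicSet_eq {α β : Fin 4 → Fin 2 → ℂ} {W : GL (Fin 2) ℂ}
    {σ : Equiv.Perm (Fin 4)} {c : Fin 4 → ℂ} (hc : ∀ i, c i ≠ 0)
    (h : ∀ i, α i = c i • W.val.mulVec (β (σ i))) :
    characteristicSet α = characteristicSet β := by
  refine (characteristicSet_subset hc h).antisymm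
    (characteristicSet_subset (W := W⁻¹) (σ := σ.symm) (c := fun i => (c (σ.symm i))⁻¹)
      (fun i => inv_ne_zero (hc _)) fun i => ?_)
  rw [h, Equiv.apply_symm_apply, Matrix.mulVec_smul, Matrix.mulVec_mulVec, ← Units.val_mul,
    inv_mul_cancel, Units.val_one, Matrix.one_mulVec, smul_smul, inv_mul_cancel₀ (hc _), one_smul]

/-! ### Equality of the weights, and the converse direction. -/

/-- Contracting `f` with `α i` on A₁ leaves a vector on A₃ that annihilates the entangled `ψ i`,
hence zero; two independent `α i` then give `f = 0`. This is the hypothesis of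
`SliceInequality.exists_inverse`. -/
theorem IsBiseparableForm.eq_zero_of_vecMul_slice {ρ : Op3} {α : Fin 4 → Fin 2 → ℂ}
    {ψ : Fin 4 → Fin 2 × Fin 2 → ℂ} (h : IsBiseparableForm ρ α ψ) {f : Fin 2 × Fin 2 → ℂ}
    (hf : ∀ c, Matrix.vecMul f (slice (fun i => vecTensor (α i) (ψ i)) c) = 0) : f = 0 := by
  have key : ∀ i, (fun l => ∑ r, f (r, l) * α i r) = 0 := by
    intro i
    refine isEntangledVec_contract_right (h.entangled i) fun k => ?_
    have := congrFun (hf (Pi.single k 1)) i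
    rw [vecMul_slice, Finset.sum_eq_single k
      (fun j _ hj => by rw [Pi.single_eq_of_ne hj, zero_mul]) (by simp), Pi.single_eq_same,
      one_mul] at this
    rw [← this.trans (Pi.zero_apply i)]
    simp only [vecTensor, Fintype.sum_prod_type, Fin.sum_univ_two]
    ring
  ext ⟨r, l⟩
  exact congrFun (vec_eq_zero_of_linearIndependent (f := fun r => f (r, l))
    (h.pairwise_indep 0 1 (by decide)) (congrFun (key 0) l) (congrFun (key 1) l)) r

/-- No combination of at most two of the `αᵢ ⊗ ψᵢ` is annihilated by a nonzero vector on `A₂`. -/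
theorem IsBiseparableForm.eq_zero_of_slice_mulVec {ρ : Op3} {α : Fin 4 → Fin 2 → ℂ}
    {ψ : Fin 4 → Fin 2 × Fin 2 → ℂ} (h : IsBiseparableForm ρ α ψ) {J : Finset (Fin 4)}
    (hJ : J.card ≤ 2) {v : Fin 4 → ℂ} (hv : v ≠ 0) (hvJ : ∀ i ∉ J, v i = 0) {e : Fin 2 → ℂ}
    (he : (slice (fun i => vecTensor (α i) (ψ i)) e).mulVec v = 0) : e = 0 := by
  obtain ⟨i, hi⟩ := Function.ne_iff.1 hv
  have hi : v i ≠ 0 := hi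
  have hiJ : i ∈ J := by
    by_contra hn
    exact hi (hvJ i hn)
  -- The support is padded to exactly two indices, so that independence of the pair `α i`, `α j`
  -- applies.
  obtain ⟨j, hij, hsub⟩ : ∃ j, i ≠ j ∧ J ⊆ {i, j} := by
    rcases (J.erase i).eq_empty_or_nonempty with h0 | ⟨j, hj⟩
    · obtain ⟨j, hj⟩ := exists_ne i
      exact ⟨j, hj.symm, fun k hk => by
        by_contra hne
        simp only [Finset.mem_insert, not_or] at hne
        simpa [h0] using Finset.mem_erase.2 ⟨hne.1, hk⟩⟩
    · have hj' := Finset.mem_erase.1 hj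
      refine ⟨j, hj'.1.symm, (Finset.eq_of_subset_of_card_le ?_ ?_).symm.subset⟩
      · simp [Finset.insert_subset_iff, hiJ, hj'.2]
      · rwa [Finset.card_pair hj'.1.symm]
  let m : Fin 4 → Fin 2 → ℂ := fun i l => ∑ k, e k * ψ i (k, l)
  have hsum : ∀ r l, v i * α i r * m i l + v j * α j r * m j l = 0 := by
    intro r l
    have := congrFun he (r, l)
    rw [Matrix.mulVec, dotProduct, ← Finset.sum_subset (Finset.subset_univ {i, j})
      (fun k _ hk => by rw [hvJ k fun hkJ => hk (hsub hkJ), mul_zero]),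
      Finset.sum_pair hij] at this
    simp only [slice, vecTensor, Matrix.of_apply, Fin.sum_univ_two, Pi.zero_apply] at this
    simp only [m, Fin.sum_univ_two]
    linear_combination this
  refine isEntangledVec_contract_left (h.entangled i) fun l => ?_
  have := LinearIndependent.pair_iff.1 (h.pairwise_indep i j hij) (v i * m i l) (v j * m j l) (by
    ext r
    simp only [Pi.add_apply, Pi.smul_apply, smul_eq_mul, Pi.zero_apply]
    linear_combination hsum r l)
  exact (mul_eq_zero.1 this.1).resolve_left hi

theorem slice_smul (x : Fin 4 → Idx3 → ℂ) (s : Fin 4 → ℂ) (b : Fin 2 → ℂ) :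
    slice (fun i => s i • x i) b = slice x b * Matrix.diagonal s := by
  ext p i
  simp only [slice, Matrix.mul_diagonal, Matrix.of_apply, Pi.smul_apply, smul_eq_mul,
    Finset.sum_mul]
  exact Finset.sum_congr rfl fun _ _ => by ring

theorem exists_not_smul (b : Fin 2 → ℂ) (hb : b ≠ 0) : ∃ c : Fin 2 → ℂ, ∀ l : ℂ, c ≠ l • b := by
  -- This vector is orthogonal to `b`.
  refine ⟨![-star (b 1), star (b 0)], fun l h => hb ?_⟩
  have h0 : -star (b 1) = l * b 0 := congrFun h 0
  have h1 : star (b 0) = l * b 1 := congrFun h 1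
  have : b ⬝ᵥ star b = 0 := by
    simp only [dotProduct, Fin.sum_univ_two, Pi.star_apply]
    linear_combination b 0 * h1 - b 1 * h0
  exact dotProduct_self_star_eq_zero.1 this

/-- The weights of the four vectors are determined up to a common factor by positivity of the
partial transpose on `A₂`. -/
theorem IsBiseparableForm.norm_eq {ρ : Op3} {α : Fin 4 → Fin 2 → ℂ}
    {ψ : Fin 4 → Fin 2 × Fin 2 → ℂ} (h : IsBiseparableForm ρ α ψ) {s : Fin 4 → ℂ}
    (hs : ∀ i, s i ≠ 0) (h1 : SliceInequality fun i => vecTensor (α i) (ψ i))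
    (h2 : SliceInequality fun i => s i • vecTensor (α i) (ψ i)) (i j : Fin 4) :
    ‖s i‖ = ‖s j‖ := by
  set x : Fin 4 → Idx3 → ℂ := fun i => vecTensor (α i) (ψ i) with hx
  obtain ⟨b, Y, hbY, hYb⟩ := h1.exists_inverse fun f => h.eq_zero_of_vecMul_slice
  have hb : b ≠ 0 := by
    rintro rfl
    have : slice x 0 = 0 := by ext; simp [slice]
    rw [this, Matrix.mul_zero] at hYb
    exact zero_ne_one (congrFun (congrFun hYb 0) 0)
  obtain ⟨c, hc⟩ := exists_not_smul b hb
  set M := Y * slice x c with hMdef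
  have hM : slice x c = slice x b * M := by
    rw [hMdef, ← Matrix.mul_assoc, hbY, Matrix.one_mul]
  set t : Fin 4 → ℝ := fun i => Complex.normSq (s i) with htdef
  have ht : ∀ i, 0 < t i := fun i => Complex.normSq_pos.2 (hs i)
  have hss : Matrix.diagonal s * Matrix.diagonal s⁻¹ = 1 := by
    rw [Matrix.diagonal_mul_diagonal, ← Matrix.diagonal_one]
    congr 1
    ext i
    exact mul_inv_cancel₀ (hs i)
  have hss' : Matrix.diagonal s⁻¹ * Matrix.diagonal s = 1 := mul_eq_one_comm.1 hss
  -- Rescaling multiplies every slice on the right by the diagonal matrix of `s`, so `M` is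
  -- conjugated by it and the squared modulus of entry `(i, j)` gains the factor `t j / t i`.
  have hN2 := h2.sum_normSq_le (b := b) (c := c) (Y := Matrix.diagonal s⁻¹ * Y)
    (M := Matrix.diagonal s⁻¹ * M * Matrix.diagonal s)
    (by rw [slice_smul, Matrix.mul_assoc, ← Matrix.mul_assoc Y, hYb, Matrix.one_mul, hss'])
    (by
      rw [slice_smul, slice_smul, ← hx, hM]
      calc slice x b * M * Matrix.diagonal s = slice x b * (1 : Matrix (Fin 4) (Fin 4) ℂ) * M *
              Matrix.diagonal s := by
            rw [Matrix.mul_one]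
        _ = _ := by rw [← hss]; simp only [Matrix.mul_assoc])
  have hentry : ∀ i j, Complex.normSq ((Matrix.diagonal s⁻¹ * M * Matrix.diagonal s) i j) =
      Complex.normSq (M i j) * (t j / t i) := by
    intro i j
    rw [Matrix.mul_diagonal, Matrix.diagonal_mul, map_mul, map_mul, Pi.inv_apply,
      Complex.normSq_inv]
    ring
  simp only [hentry] at hN2
  obtain ⟨j₀, hj₀⟩ := Finite.exists_max t
  suffices hall : ∀ i, t i = t j₀ by
    have := (hall i).trans (hall j).symm
    simp only [htdef, Complex.normSq_eq_norm_sq] at this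
    exact (sq_eq_sq₀ (norm_nonneg _) (norm_nonneg _)).1 this
  by_contra hnot
  push Not at hnot
  obtain ⟨i₀, hi₀⟩ := hnot
  have hblock : ∀ i j, t i ≠ t j₀ → t j = t j₀ → M i j = 0 ∧ M j i = 0 := by
    intro i j hi hj
    have := entries_eq_zero_of_row_col (N := fun i j => Complex.normSq (M i j))
      (fun _ _ => Complex.normSq_nonneg _) ht (h1.sum_normSq_le hYb hM) hN2
      (j := j) (fun k => hj ▸ hj₀ k) (hj ▸ hi)
    exact ⟨Complex.normSq_eq_zero.1 this.1, Complex.normSq_eq_zero.1 this.2⟩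
  have hend : ∀ J : Finset (Fin 4), J.Nonempty → J.card ≤ 2 →
      (∀ i ∉ J, ∀ j ∈ J, M i j = 0) → False := by
    intro J hJ hcard hMJ
    obtain ⟨l, v, hv, hvJ, hl⟩ := exists_eigenvector_supported hJ hMJ
    have he := h.eq_zero_of_slice_mulVec hcard hv hvJ (e := c + (-l) • b) (by
      rw [← hx, slice_add_smul, Matrix.add_mulVec, Matrix.smul_mulVec, hM, ← Matrix.mulVec_mulVec,
        hl, Matrix.mulVec_smul, neg_smul, add_neg_cancel])
    rw [neg_smul] at he
    exact hc l (add_neg_eq_zero.1 he)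
  let I : Finset (Fin 4) := Finset.univ.filter fun i => t i = t j₀
  have hmem : ∀ i, i ∈ I ↔ t i = t j₀ := fun i => by simp [I]
  -- Among four indices either the level set of the maximum or its complement has at most two
  -- elements, and `M` preserves both blocks.
  by_cases hcard : I.card ≤ 2
  · refine hend I ⟨j₀, (hmem _).2 rfl⟩ hcard fun i hi j hj => ?_
    exact (hblock i j (mt (hmem i).2 hi) ((hmem j).1 hj)).1
  · refine hend Iᶜ ⟨i₀, by rw [Finset.mem_compl, hmem]; exact hi₀⟩ ?_ fun i hi j hj => ?_
    · rw [Finset.card_compl, Fintype.card_fin]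
      omega
    · rw [Finset.mem_compl, not_not] at hi
      rw [Finset.mem_compl] at hj
      exact (hblock j i (mt (hmem j).2 hj) ((hmem i).1 hi)).2

theorem SLOCCEquivalent_of_productVectorsMatch {P Q : Op3} {α β : Fin 4 → Fin 2 → ℂ}
    {ψ φ : Fin 4 → Fin 2 × Fin 2 → ℂ} (hPpt : IsPPT P) (hQpt : IsPPT Q)
    (hP : IsBiseparableForm P α ψ) (hQ : IsBiseparableForm Q β φ)
    {W₁ W₂ W₃ : GL (Fin 2) ℂ} {σ : Equiv.Perm (Fin 4)} {d : Fin 4 → ℂ} (hd : ∀ i, d i ≠ 0)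
    (h : ProductVectorsMatch α β ψ φ W₁ W₂ W₃ σ d) : SLOCCEquivalent P Q := by
  set W := prodOp W₁.val W₂.val W₃.val with hW
  have h1 : SliceInequality fun i => vecTensor (α i) (ψ i) :=
    sliceInequality_of_posSemidef (hP.eq_sum_ketbra ▸ hPpt.2.2.1)
  -- Dividing by `d i` gives the image under `W` of the vectors of `Q`, which inherits the
  -- inequality from the positivity for `Q`.
  have h2 : SliceInequality fun i => (d i)⁻¹ • vecTensor (α i) (ψ i) := by
    have := ((sliceInequality_of_posSemidef (hQ.eq_sum_ketbra ▸ hQpt.2.2.1)).comp_equiv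
      σ).prodOp_mulVec W₁.val W₂.val W₃.val
    convert this using 2 with i
    rw [h i, smul_smul, inv_mul_cancel₀ (hd i), one_smul]
  have hnorm : ∀ i, ‖d i‖ = ‖d 0‖ := by
    intro i
    have := hP.norm_eq (fun i => inv_ne_zero (hd i)) h1 h2 i 0
    simpa using this
  -- The common modulus of the `d i` goes into `W₁`; the phases vanish in `ketbra`.
  let u : ℂˣ := Units.mk0 (‖d 0‖ : ℂ) (by simpa using hd 0)
  refine ⟨u • W₁, W₂, W₃, ?_⟩
  have hu : prodOp (u • W₁).val W₂.val W₃.val = (‖d 0‖ : ℂ) • W := by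
    rw [hW, prodOp, prodOp, ← Matrix.smul_kronecker]
    rfl
  rw [hu, hQ.eq_sum_ketbra, ← Equiv.sum_comp σ, Finset.mul_sum, Finset.sum_mul, hP.eq_sum_ketbra]
  refine Finset.sum_congr rfl fun i _ => ?_
  rw [mul_ketbra_mul, Matrix.smul_mulVec, ketbra_smul, h i, ketbra_smul, hnorm i, hW]
  simp

theorem mainTheorem10 (P Q : Op3) (hP : IsRankFourPPTES P) (hQ : IsRankFourPPTES Q)
    (α β : Fin 4 → Fin 2 → ℂ) (ψ φ : Fin 4 → Fin 2 × Fin 2 → ℂ)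
    (hPform : IsBiseparableForm P α ψ) (hQform : IsBiseparableForm Q β φ) :
    (SLOCCEquivalent P Q ↔
      ∃ (W₁ W₂ W₃ : GL (Fin 2) ℂ) (σ : Equiv.Perm (Fin 4)) (d : Fin 4 → ℂ),
        (∀ i, d i ≠ 0) ∧ ProductVectorsMatch α β ψ φ W₁ W₂ W₃ σ d) ∧
    (SLOCCEquivalent P Q ↔
      ∃ (W₁ W₂ W₃ : GL (Fin 2) ℂ) (σ : Equiv.Perm (Fin 4)) (d : Fin 4 → ℂ),
        (∀ i, ‖d i‖ = 1) ∧ ProductVectorsMatch α β ψ φ W₁ W₂ W₃ σ d) ∧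
    (SLOCCEquivalent P Q → characteristicSet α = characteristicSet β) := by
  have hne : ∀ {d : Fin 4 → ℂ}, (∀ i, ‖d i‖ = 1) → ∀ i, d i ≠ 0 := fun hd i h0 => by
    simpa [h0] using hd i
  refine ⟨⟨fun h => ?_, ?_⟩, ⟨productVectorsMatch_of_SLOCC hPform hQform, ?_⟩, fun h => ?_⟩
  · obtain ⟨W₁, W₂, W₃, σ, d, hd, hm⟩ := productVectorsMatch_of_SLOCC hPform hQform h
    exact ⟨W₁, W₂, W₃, σ, d, hne hd, hm⟩
  · rintro ⟨W₁, W₂, W₃, σ, d, hd, hm⟩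
    exact SLOCCEquivalent_of_productVectorsMatch hP.ppt hQ.ppt hPform hQform hd hm
  · rintro ⟨W₁, W₂, W₃, σ, d, hd, hm⟩
    exact SLOCCEquivalent_of_productVectorsMatch hP.ppt hQ.ppt hPform hQform (hne hd) hm
  · obtain ⟨W₁, W₂, W₃, σ, d, hd, hm⟩ := productVectorsMatch_of_SLOCC hPform hQform h
    obtain ⟨c, hc, hα⟩ := exists_smul_of_productVectorsMatch hPform.ne_zero
      (fun i => hPform.indep.ne_zero i) hm
    exact characteristicSet_eq hc hα
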